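/- Let $k$ be a commutative ring and let $A$ be a (left) gabi-algebra over $k$, that is, a $k$-algebra with $k$-algebra maps $\varepsilon\colon A\to k$ and $\delta\colon A\to A\otimes_k A^{\mathrm{op}}$, $\delta(a)=a_+\otimes a_-$ (summation understood), such that for all $a\in A$ $$a_+\,\varepsilon(a_-)=a,\qquad a_+a_-=\varepsilon(a)1_A,\qquad a_{++}\otimes a_{-+}\otimes a_{--}a_{+-}=a_+\otimes a_-\otimes 1_A .$$ For a left $A$-module $N$ let $A\odot N$ be the $k$-module $A\otimes_k N$ with the $A$-bimodule structure $a\cdot(b\otimes n)\cdot c=abc_+\otimes c_-n$, and for left $A$-modules $M,N$ put $M\boxtimes N=(A\odot N)\otimes_A M$; this is a bifunctor on the category $A\text{-}\mathrm{Mod}$ of left $A$-modules. Let $k$ be an $A$-module via $\varepsilon$. Then $\boxtimes$ carries a left skew-monoidal structure on $A\text{-}\mathrm{Mod}$ with unit object $k$, left unitor $$\lambda_N\colon k\boxtimes N\to N,\qquad (a\odot n)\otimes_A 1_k\mapsto an,$$ right unitor $$\rho_M\colon M\to M\boxtimes k,\qquad m\mapsto(1_A\odot 1_k)\otimes_A m,$$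 which is always an isomorphism, and associator $\alpha_{L,M,N}\colon (L\boxtimes M)\boxtimes N\to L\boxtimes(M\boxtimes N)$, $$(a\odot n)\otimes_A\big((b\odot m)\otimes_A l\big)\mapsto\Big(ab_+\odot\big((1_A\odot b_-n)\otimes_A m\big)\Big)\otimes_A l .$$ Moreover, this structure is strong (i.e. $\lambda$, $\rho$ and $\alpha$ are isomorphisms, so that it is a monoidal structure) if and only if $A$ is a normal gabi-algebra, meaning that the following left skew-closed structure on $A\text{-}\mathrm{Mod}$ is left, right and associative normal: the internal hom is $[M,N]=\mathrm{Hom}_k(M,N)$ with $(a\cdot f)(m)=a_+f(a_-m)$, the unit object is $k$, and the structure maps are $i_M\colon[k,M]\to M$, $f\mapsto f(1_k)$; $j_M\colon k\to[M,M]$, $r\mapsto r\,\mathrm{id}_M$; and $\Gamma^X_{Y,Z}\colon[Y,Z]\to[[X,Y],[X,Z]]$, $f\mapsto f\circ-$. Here, writing $\mathcal C=A\text{-}\mathrm{Mod}$, left normal means that $\mathcal C(X,Y)\to\mathcal C(k,[X,Y])$, $f\mapsto[f,Y]\circ j_Y$, is bijective for all $X,Y$; right normal means that every $i_M$ is an isomorphism;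 and associative normal means that the canonical map $$\int^{V\in\mathcal C}\mathcal C(U,[V,Z])\times\mathcal C(X,[Y,V])\to\mathcal C(U,[X,[Y,Z]]),\qquad (f,g)\mapsto[g,[Y,Z]]\circ\Gamma^Y_{V,Z}\circ f,$$ is bijective for all $U,X,Y,Z$. -/

import Mathlib

open CategoryTheory TensorProduct MulOpposite

universe v u

/-! ### Skew-closed and skew-monoidal categories -/

section Categorical

variable {C : Type u} [Category.{v} C]

/-- A left skew-closed structure on a category `C` with unit object `I` and internal hom functor
`H`, where `(H.obj (op X)).obj Y` is the internal hom `[X, Y]`. -/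
structure SkewClosedStructure (H : Cᵒᵖ ⥤ C ⥤ C) (I : C) where
  /-- `i_X : [1, X] ⟶ X` -/
  i : ∀ X : C, (H.obj (.op I)).obj X ⟶ X
  /-- `j_X : 1 ⟶ [X, X]` -/
  j : ∀ X : C, I ⟶ (H.obj (.op X)).obj X
  /-- `Γ^X_{Y, Z} : [Y, Z] ⟶ [[X, Y], [X, Z]]` -/
  Γ : ∀ X Y Z : C, (H.obj (.op Y)).obj Z ⟶
    (H.obj (.op ((H.obj (.op X)).obj Y))).obj ((H.obj (.op X)).obj Z)
  i_natural : ∀ {X Y : C} (f : X ⟶ Y), (H.obj (.op I)).map f ≫ i Y = i X ≫ f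
  j_dinatural : ∀ {X Y : C} (f : X ⟶ Y),
    j X ≫ (H.obj (.op X)).map f = j Y ≫ (H.map f.op).app Y
  Γ_natural_left : ∀ (X : C) {Y Y' : C} (f : Y ⟶ Y') (Z : C),
    (H.map f.op).app Z ≫ Γ X Y Z =
      Γ X Y' Z ≫ (H.map ((H.obj (.op X)).map f).op).app ((H.obj (.op X)).obj Z)
  Γ_natural_right : ∀ (X Y : C) {Z Z' : C} (f : Z ⟶ Z'),
    (H.obj (.op Y)).map f ≫ Γ X Y Z' =
      Γ X Y Z ≫ (H.obj (.op ((H.obj (.op X)).obj Y))).map ((H.obj (.op X)).map f)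
  Γ_dinatural : ∀ {X X' : C} (f : X ⟶ X') (Y Z : C),
    Γ X Y Z ≫ (H.map ((H.map f.op).app Y).op).app ((H.obj (.op X)).obj Z) =
      Γ X' Y Z ≫ (H.obj (.op ((H.obj (.op X')).obj Y))).map ((H.map f.op).app Z)
  j_i : j I ≫ i I = 𝟙 I
  Γ_j_i : ∀ X Y : C,
    Γ X X Y ≫ (H.map (j X).op).app ((H.obj (.op X)).obj Y) ≫ i ((H.obj (.op X)).obj Y) = 𝟙 _
  j_Γ : ∀ X Y : C, j Y ≫ Γ X Y Y = j ((H.obj (.op X)).obj Y)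
  Γ_i : ∀ X Y : C,
    Γ I X Y ≫ (H.obj (.op ((H.obj (.op I)).obj X))).map (i Y) = (H.map (i X).op).app Y
  Γ_Γ : ∀ U V W X : C,
    Γ U W X ≫ Γ ((H.obj (.op U)).obj V) ((H.obj (.op U)).obj W) ((H.obj (.op U)).obj X) ≫
        (H.map (Γ U V W).op).app _ =
      Γ V W X ≫ (H.obj (.op ((H.obj (.op V)).obj W))).map (Γ U V X)

namespace SkewClosedStructure

variable {H : Cᵒᵖ ⥤ C ⥤ C} {I : C} (S : SkewClosedStructure H I)

/-- Left normality: `C(X, Y) → C(1, [X, Y])`, `f ↦ [f, Y] ∘ j_Y`, is bijective. -/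
def IsLeftNormal : Prop :=
  ∀ X Y : C, Function.Bijective (fun f : X ⟶ Y => S.j Y ≫ (H.map f.op).app Y)

/-- Right normality: `i` is an isomorphism. -/
def IsRightNormal : Prop := ∀ X : C, IsIso (S.i X)

/-- The elements `(V, f, g)` of the disjoint union over `V` of `C(U, [V, Z]) × C(X, [Y, V])`. -/
def PreCoend (H : Cᵒᵖ ⥤ C ⥤ C) (U X Y Z : C) : Type (max u v) :=
  Σ V : C, (U ⟶ (H.obj (.op V)).obj Z) × (X ⟶ (H.obj (.op Y)).obj V)

/-- The relation generating the coend: `(V, [h, Z] ∘ f, g) ∼ (V', f, [Y, h] ∘ g)` for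
`h : V ⟶ V'`, `f : U ⟶ [V', Z]` and `g : X ⟶ [Y, V]`. -/
inductive CoendRel (H : Cᵒᵖ ⥤ C ⥤ C) (U X Y Z : C) :
    PreCoend H U X Y Z → PreCoend H U X Y Z → Prop
  | mk {V V' : C} (h : V ⟶ V') (f : U ⟶ (H.obj (.op V')).obj Z)
      (g : X ⟶ (H.obj (.op Y)).obj V) :
      CoendRel H U X Y Z ⟨V, f ≫ (H.map h.op).app Z, g⟩ ⟨V', f, g ≫ (H.obj (.op Y)).map h⟩

/-- The coend `∫^V C(U, [V, Z]) × C(X, [Y, V])` of sets, as the quotient of the disjoint union by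
the equivalence relation generated by `CoendRel`. -/
def Coend (H : Cᵒᵖ ⥤ C ⥤ C) (U X Y Z : C) : Type (max u v) := Quot (CoendRel H U X Y Z)

/-- The canonical map `∫^V C(U, [V, Z]) × C(X, [Y, V]) → C(U, [X, [Y, Z]])`, sending the class of
`(f, g)` to `[g, [Y, Z]] ∘ Γ^Y_{V, Z} ∘ f`. -/
def coendMap (U X Y Z : C) :
    Coend H U X Y Z → (U ⟶ (H.obj (.op X)).obj ((H.obj (.op Y)).obj Z)) :=
  Quot.lift (fun p => p.2.1 ≫ S.Γ Y p.1 Z ≫ (H.map p.2.2.op).app ((H.obj (.op Y)).obj Z)) (by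
    rintro _ _ ⟨h, f, g⟩
    have := S.Γ_natural_left Y h Z
    simp only [Category.assoc, op_comp, Functor.map_comp, NatTrans.comp_app]
    rw [reassoc_of% this])

/-- Associative normality: the canonical map out of the coend is always bijective. -/
def IsAssociativeNormal : Prop := ∀ U X Y Z : C, Function.Bijective (S.coendMap U X Y Z)

/-- A skew-closed structure is normal if it is left, right and associative normal. -/
def IsNormal : Prop := S.IsLeftNormal ∧ S.IsRightNormal ∧ S.IsAssociativeNormal

end SkewClosedStructure

/-- A left skew-monoidal structure on a category `C` with unit object `I` and product bifunctor
`T`, where `(T.obj X).obj Y` is the product `X ⊗ Y`; thus `(T.map f).app Y` is `f ⊗ Y` and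
`(T.obj X).map g` is `X ⊗ g`. -/
structure SkewMonoidalStructure (T : C ⥤ C ⥤ C) (I : C) where
  /-- `α_{X, Y, Z} : (X ⊗ Y) ⊗ Z ⟶ X ⊗ (Y ⊗ Z)` -/
  α : ∀ X Y Z : C, (T.obj ((T.obj X).obj Y)).obj Z ⟶ (T.obj X).obj ((T.obj Y).obj Z)
  /-- `l_X : 1 ⊗ X ⟶ X` -/
  l : ∀ X : C, (T.obj I).obj X ⟶ X
  /-- `ρ_X : X ⟶ X ⊗ 1` -/
  ρ : ∀ X : C, X ⟶ (T.obj X).obj I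
  α_natural_left : ∀ {X X' : C} (f : X ⟶ X') (Y Z : C),
    (T.map ((T.map f).app Y)).app Z ≫ α X' Y Z = α X Y Z ≫ (T.map f).app ((T.obj Y).obj Z)
  α_natural_middle : ∀ (X : C) {Y Y' : C} (f : Y ⟶ Y') (Z : C),
    (T.map ((T.obj X).map f)).app Z ≫ α X Y' Z = α X Y Z ≫ (T.obj X).map ((T.map f).app Z)
  α_natural_right : ∀ (X Y : C) {Z Z' : C} (f : Z ⟶ Z'),
    (T.obj ((T.obj X).obj Y)).map f ≫ α X Y Z' = α X Y Z ≫ (T.obj X).map ((T.obj Y).map f)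
  l_natural : ∀ {X Y : C} (f : X ⟶ Y), (T.obj I).map f ≫ l Y = l X ≫ f
  ρ_natural : ∀ {X Y : C} (f : X ⟶ Y), f ≫ ρ Y = ρ X ≫ (T.map f).app I
  pentagon : ∀ W X Y Z : C,
    (T.map (α W X Y)).app Z ≫ α W ((T.obj X).obj Y) Z ≫ (T.obj W).map (α X Y Z) =
      α ((T.obj W).obj X) Y Z ≫ α W X ((T.obj Y).obj Z)
  ρ_α : ∀ X Y : C, ρ ((T.obj X).obj Y) ≫ α X Y I = (T.obj X).map (ρ Y)
  α_l : ∀ X Y : C, α I X Y ≫ l ((T.obj X).obj Y) = (T.map (l X)).app Y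
  ρ_α_l : ∀ X Y : C, (T.map (ρ X)).app Y ≫ α X I Y ≫ (T.obj X).map (l Y) = 𝟙 _
  ρ_l : ρ I ≫ l I = 𝟙 I

/-- A skew-monoidal structure is strong (i.e. monoidal) if the associator and both unitors are
isomorphisms. -/
def SkewMonoidalStructure.IsStrong {T : C ⥤ C ⥤ C} {I : C} (S : SkewMonoidalStructure T I) : Prop :=
  (∀ X : C, IsIso (S.l X)) ∧ (∀ X : C, IsIso (S.ρ X)) ∧ (∀ X Y Z : C, IsIso (S.α X Y Z))

end Categorical

/-! ### Gabi-algebras -/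

/-- The `k`-linear map `A → A ⊗ A`, `a ↦ a₊ ⊗ a₋`, underlying `δ : A → A ⊗ Aᵒᵖ`, obtained by
forgetting the opposite multiplication on the second tensor factor. -/
def forgetOp {k A : Type u} [CommRing k] [Ring A] [Algebra k A]
    (δ : A →ₐ[k] A ⊗[k] Aᵐᵒᵖ) : A →ₗ[k] A ⊗[k] A :=
  (TensorProduct.map LinearMap.id (opLinearEquiv k).symm.toLinearMap) ∘ₗ δ.toLinearMap

/-- A (left) gabi-algebra structure on a `k`-algebra `A`: an augmentation `ε` and an algebra map
`δ : A → A ⊗ Aᵒᵖ`, `δ a = a₊ ⊗ a₋`, subject to three axioms. -/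
structure GabiAlgebra (k A : Type u) [CommRing k] [Ring A] [Algebra k A] where
  ε : A →ₐ[k] k
  δ : A →ₐ[k] A ⊗[k] Aᵐᵒᵖ
  /-- `a₊ ε(a₋) = a` -/
  counit : ∀ a : A,
    TensorProduct.rid k A (TensorProduct.map LinearMap.id ε.toLinearMap (forgetOp δ a)) = a
  /-- `a₊ a₋ = ε(a) 1` -/
  antipode : ∀ a : A, LinearMap.mul' k A (forgetOp δ a) = algebraMap k A (ε a)
  /-- `a₊₊ ⊗ a₋₊ ⊗ a₋₋ a₊₋ = a₊ ⊗ a₋ ⊗ 1`. Applying `δ` to both legs of `a₊ ⊗ a₋` gives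
  `(a₊₊ ⊗ a₊₋) ⊗ (a₋₊ ⊗ a₋₋)`, the middle interchange gives `(a₊₊ ⊗ a₋₊) ⊗ (a₊₋ ⊗ a₋₋)`, and the
  last two legs are multiplied in the opposite order. -/
  assoc : ∀ a : A,
    TensorProduct.map LinearMap.id (LinearMap.mul' k A ∘ₗ (TensorProduct.comm k A A).toLinearMap)
      (TensorProduct.tensorTensorTensorComm k A A A A
        (TensorProduct.map (forgetOp δ) (forgetOp δ) (forgetOp δ a))) =
      forgetOp δ a ⊗ₜ[k] (1 : A)

namespace GabiAlgebra

variable {k A : Type u} [CommRing k] [Ring A] [Algebra k A]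

/-- The underlying `k`-module of an `A`-module. -/
instance kModule (M : ModuleCat.{u} A) : Module k M := Module.compHom M (algebraMap k A)

instance (M : ModuleCat.{u} A) : IsScalarTower k A M where
  smul_assoc r a m := by
    change (r • a) • m = algebraMap k A r • (a • m)
    rw [Algebra.smul_def, mul_smul]

instance (M : ModuleCat.{u} A) : SMulCommClass A k M := IsScalarTower.to_smulCommClass'
instance (M : ModuleCat.{u} A) : SMulCommClass k A M := IsScalarTower.to_smulCommClass

section Hom

variable (M N : ModuleCat.{u} A)

/-- `A ⊗ Aᵒᵖ` acts on `Hom_k(M, N)` by `((x ⊗ y) . f)(m) = x f(y m)`. -/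
def homRep : A ⊗[k] Aᵐᵒᵖ →ₐ[k] Module.End k (M →ₗ[k] N) :=
  Algebra.TensorProduct.lift
    (AlgHom.ofLinearMap (LinearMap.llcomp k M N N ∘ₗ (Algebra.lsmul k k N).toLinearMap)
      (by ext; simp) (by intros; ext; simp))
    (AlgHom.ofLinearMap ((LinearMap.llcomp k M M N).flip ∘ₗ (Algebra.lsmul k k M).toLinearMap ∘ₗ
        (opLinearEquiv k).symm.toLinearMap)
      (by ext; simp) (by intros; ext; simp))
    (fun x y => by rw [commute_iff_eq]; ext; simp)

@[simp] lemma homRep_tmul (x : A) (y : Aᵐᵒᵖ) (f : M →ₗ[k] N) (m : M) :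
    homRep M N (x ⊗ₜ y) f m = x • f (y.unop • m) := by
  rw [homRep, Algebra.TensorProduct.lift_tmul]
  simp

end Hom

variable (G : GabiAlgebra k A)

/-- The `A`-module structure `(a . f)(m) = a₊ f(a₋ m)` on `Hom_k(M, N)`. -/
@[reducible] def homModule (M N : ModuleCat.{u} A) : Module A (M →ₗ[k] N) :=
  Module.compHom _ ((homRep M N).comp G.δ).toRingHom

/-- The internal hom `[M, N] = Hom_k(M, N)` of `A`-modules. -/
def ihomObj (M N : ModuleCat.{u} A) : ModuleCat.{u} A :=
  @ModuleCat.of A _ (M →ₗ[k] N) _ (G.homModule M N)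

/-- The elements of the internal hom are the `k`-linear maps. -/
def ihomEquiv (M N : ModuleCat.{u} A) : G.ihomObj M N ≃+ (M →ₗ[k] N) := AddEquiv.refl _

lemma ihomEquiv_smul {M N : ModuleCat.{u} A} (a : A) (f : G.ihomObj M N) :
    G.ihomEquiv M N (a • f) = homRep M N (G.δ a) (G.ihomEquiv M N f) := rfl

lemma homRep_natural {M M' N N' : ModuleCat.{u} A} (f : M' ⟶ M) (g : N ⟶ N')
    (t : A ⊗[k] Aᵐᵒᵖ) (φ : M →ₗ[k] N) :
    homRep M' N' t (g.hom.restrictScalars k ∘ₗ φ ∘ₗ f.hom.restrictScalars k) =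
      g.hom.restrictScalars k ∘ₗ homRep M N t φ ∘ₗ f.hom.restrictScalars k := by
  induction t with
  | zero => ext; simp
  | tmul x y => ext; simp
  | add s t hs ht =>
    rw [map_add, map_add, LinearMap.add_apply, LinearMap.add_apply, hs, ht]
    ext; simp

/-- The action `φ ↦ g ∘ φ ∘ f` of the internal hom on morphisms. -/
def ihomMap {M M' N N' : ModuleCat.{u} A} (f : M' ⟶ M) (g : N ⟶ N') :
    G.ihomObj M N ⟶ G.ihomObj M' N' :=
  ModuleCat.ofHom (X := G.ihomObj M N) (Y := G.ihomObj M' N')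
    { toFun := fun φ => (G.ihomEquiv M' N').symm
        (g.hom.restrictScalars k ∘ₗ G.ihomEquiv M N φ ∘ₗ f.hom.restrictScalars k)
      map_add' := fun φ ψ => (G.ihomEquiv M' N').injective (by ext; simp)
      map_smul' := fun a φ => (G.ihomEquiv M' N').injective
        (homRep_natural f g (G.δ a) (G.ihomEquiv M N φ)).symm }

@[simp] lemma ihomMap_apply {M M' N N' : ModuleCat.{u} A} (f : M' ⟶ M) (g : N ⟶ N')
    (φ : G.ihomObj M N) (m : M') :
    G.ihomEquiv M' N' (G.ihomMap f g φ) m = g (G.ihomEquiv M N φ (f m)) := rfl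

variable {G} in
@[ext] lemma ihom_ext {M N : ModuleCat.{u} A} {φ ψ : G.ihomObj M N}
    (h : ∀ m : M, G.ihomEquiv M N φ m = G.ihomEquiv M N ψ m) : φ = ψ :=
  (G.ihomEquiv M N).injective (LinearMap.ext h)

/-- The internal hom functor `[-, -]` of `A-Mod`. -/
def ihom : (ModuleCat.{u} A)ᵒᵖ ⥤ ModuleCat.{u} A ⥤ ModuleCat.{u} A where
  obj M :=
    { obj := fun N => G.ihomObj M.unop N
      map := fun g => G.ihomMap (𝟙 _) g
      map_id := fun _ => rfl
      map_comp := fun _ _ => rfl }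
  map f :=
    { app := fun N => G.ihomMap f.unop (𝟙 N)
      naturality := fun _ _ _ => rfl }
  map_id _ := rfl
  map_comp _ _ := rfl

/-- The unit object: `k` with the action `a . r = ε(a) r`. -/
def unit : ModuleCat.{u} A :=
  @ModuleCat.of A _ k _ (Module.compHom k (G.ε : A →+* k))

/-- The elements of the unit object are the elements of `k`. -/
def unitEquiv : G.unit ≃+ k := AddEquiv.refl k

lemma unitEquiv_smul (a : A) (r : G.unit) : G.unitEquiv (a • r) = G.ε a * G.unitEquiv r := rfl

/-- The element `1` of the unit object `k`. -/
def one : G.unit := G.unitEquiv.symm 1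

@[simp] lemma unitEquiv_one : G.unitEquiv G.one = 1 := rfl

lemma kModule_smul (M : ModuleCat.{u} A) (r : k) (m : M) : r • m = algebraMap k A r • m := rfl

@[simp] lemma ihomEquiv_ksmul {M N : ModuleCat.{u} A} (r : k) (f : G.ihomObj M N) :
    G.ihomEquiv M N (r • f) = r • G.ihomEquiv M N f := by
  rw [kModule_smul, ihomEquiv_smul, AlgHom.commutes, AlgHom.commutes]
  rfl

@[simp] lemma unitEquiv_ksmul (r : k) (x : G.unit) : G.unitEquiv (r • x) = r * G.unitEquiv x := by
  rw [kModule_smul, unitEquiv_smul, AlgHom.commutes]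
  rfl

lemma unit_eq_smul_one (x : G.unit) : x = G.unitEquiv x • G.one :=
  G.unitEquiv.injective (by simp)

lemma forgetOp_apply (δ : A →ₐ[k] A ⊗[k] Aᵐᵒᵖ) (a : A) : forgetOp δ a =
    TensorProduct.map LinearMap.id (opLinearEquiv k).symm.toLinearMap (δ a) := rfl

lemma homRep_one (M : ModuleCat.{u} A) (t : A ⊗[k] Aᵐᵒᵖ) (φ : G.unit →ₗ[k] M) :
    homRep G.unit M t φ G.one =
      TensorProduct.rid k A (TensorProduct.map LinearMap.id G.ε.toLinearMap
        (TensorProduct.map LinearMap.id (opLinearEquiv k).symm.toLinearMap t)) • φ G.one := by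
  induction t with
  | zero => simp
  | tmul x y =>
    have : y.unop • G.one = G.ε y.unop • G.one :=
      G.unitEquiv.injective (by simp [unitEquiv_smul])
    simp only [homRep_tmul, this, map_smul, TensorProduct.map_tmul, LinearMap.id_coe, id_eq,
      LinearEquiv.coe_coe, coe_opLinearEquiv_symm, AlgHom.toLinearMap_apply,
      TensorProduct.rid_tmul, smul_assoc]
    exact smul_comm _ _ _
  | add s t hs ht => simp [add_smul, hs, ht]

/-- `i_M : Hom_k(k, M) → M`, `f ↦ f(1)`. -/
def iLin (M : ModuleCat.{u} A) : G.ihomObj G.unit M →ₗ[A] M where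
  toFun f := G.ihomEquiv _ _ f G.one
  map_add' _ _ := by simp
  map_smul' a f := by
    rw [RingHom.id_apply, ihomEquiv_smul, homRep_one]
    congr 1
    exact G.counit a

@[simp] lemma iLin_apply (M : ModuleCat.{u} A) (f : G.ihomObj G.unit M) :
    G.iLin M f = G.ihomEquiv _ _ f G.one := rfl

lemma homRep_id (M : ModuleCat.{u} A) (t : A ⊗[k] Aᵐᵒᵖ) (r : k) (m : M) :
    homRep M M t (r • LinearMap.id) m =
      LinearMap.mul' k A
        (TensorProduct.map LinearMap.id (opLinearEquiv k).symm.toLinearMap t) • (r • m) := by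
  induction t with
  | zero => simp
  | tmul x y =>
    simp only [homRep_tmul, LinearMap.smul_apply, LinearMap.id_coe, id_eq, TensorProduct.map_tmul,
      LinearEquiv.coe_coe, coe_opLinearEquiv_symm, LinearMap.mul'_apply, mul_smul]
    rw [smul_comm r]
  | add s t hs ht => rw [map_add, LinearMap.add_apply, LinearMap.add_apply, hs, ht, map_add,
      map_add, add_smul]

/-- `j_M : k → Hom_k(M, M)`, `r ↦ r id`. -/
def jLin (M : ModuleCat.{u} A) : G.unit →ₗ[A] G.ihomObj M M where
  toFun r := (G.ihomEquiv M M).symm (G.unitEquiv r • LinearMap.id)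
  map_add' r s := by simp [add_smul]
  map_smul' a r := by
    ext m
    rw [RingHom.id_apply, ihomEquiv_smul, AddEquiv.apply_symm_apply, AddEquiv.apply_symm_apply,
      homRep_id, ← forgetOp_apply, G.antipode a, unitEquiv_smul, algebraMap_smul, ← mul_smul]
    rfl

@[simp] lemma jLin_apply (M : ModuleCat.{u} A) (r : G.unit) (m : M) :
    G.ihomEquiv M M (G.jLin M r) m = G.unitEquiv r • m := rfl

/-- Post-composition with a fixed `k`-linear map. -/
def postcomp (X : ModuleCat.{u} A) {Y Z : ModuleCat.{u} A} (f : Y →ₗ[k] Z) :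
    G.ihomObj X Y →ₗ[k] G.ihomObj X Z where
  toFun g := (G.ihomEquiv X Z).symm (f ∘ₗ G.ihomEquiv X Y g)
  map_add' _ _ := by ext; simp
  map_smul' _ _ := by ext; simp

@[simp] lemma postcomp_apply (X : ModuleCat.{u} A) {Y Z : ModuleCat.{u} A} (f : Y →ₗ[k] Z)
    (g : G.ihomObj X Y) : G.ihomEquiv X Z (G.postcomp X f g) = f ∘ₗ G.ihomEquiv X Y g := rfl

/-- The map `(p ⊗ r) ⊗ s ↦ p φ(r ψ(s x))`. -/
def tripleEval {X Y Z : ModuleCat.{u} A} (φ : Y →ₗ[k] Z) (ψ : X →ₗ[k] Y) (x : X) :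
    (A ⊗[k] A) ⊗[k] A →ₗ[k] Z :=
  TensorProduct.lift (TensorProduct.lift
    (LinearMap.mk₂ k (fun p r =>
      (Algebra.lsmul k k Z p ∘ₗ φ ∘ₗ Algebra.lsmul k k Y r ∘ₗ ψ) ∘ₗ
        (LinearMap.toSpanSingleton A X x).restrictScalars k)
      (by intros; ext; simp) (by intros; ext; simp)
      (by intros; ext; simp) (by intros; ext; simpa using smul_comm _ _ _)))

@[simp] lemma tripleEval_tmul {X Y Z : ModuleCat.{u} A} (φ : Y →ₗ[k] Z) (ψ : X →ₗ[k] Y) (x : X)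
    (p r s : A) : tripleEval φ ψ x ((p ⊗ₜ r) ⊗ₜ s) = p • φ (r • ψ (s • x)) := rfl

lemma homRep_eq_tripleEval {X Y Z : ModuleCat.{u} A} (φ : Y →ₗ[k] Z) (ψ : X →ₗ[k] Y) (x : X)
    (t : A ⊗[k] Aᵐᵒᵖ) : homRep Y Z t φ (ψ x) = tripleEval φ ψ x
      (TensorProduct.map LinearMap.id (opLinearEquiv k).symm.toLinearMap t ⊗ₜ 1) := by
  induction t with
  | zero => simp
  | tmul y z => simp
  | add s t hs ht => simp [hs, ht, TensorProduct.add_tmul]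

lemma homRep_homRep {X Y Z : ModuleCat.{u} A} (φ : Y →ₗ[k] Z) (ψ : X →ₗ[k] Y) (x : X)
    (s t : A ⊗[k] Aᵐᵒᵖ) : homRep X Z s (φ ∘ₗ homRep X Y t ψ) x = tripleEval φ ψ x
      (TensorProduct.map LinearMap.id (LinearMap.mul' k A ∘ₗ (TensorProduct.comm k A A).toLinearMap)
        (TensorProduct.tensorTensorTensorComm k A A A A
          (TensorProduct.map LinearMap.id (opLinearEquiv k).symm.toLinearMap s ⊗ₜ
            TensorProduct.map LinearMap.id (opLinearEquiv k).symm.toLinearMap t))) := by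
  induction s with
  | zero => simp
  | add s s' hs hs' => simp [hs, hs', TensorProduct.add_tmul]
  | tmul p q =>
    induction t with
    | zero => simp
    | add t t' ht ht' =>
      simp only [map_add, LinearMap.comp_add, LinearMap.add_apply, ht, ht', TensorProduct.tmul_add]
    | tmul r s => simp [mul_smul]

lemma homRep_postcomp {X Y Z : ModuleCat.{u} A} (φ : Y →ₗ[k] Z) (g : G.ihomObj X Y) (x : X)
    (t : A ⊗[k] Aᵐᵒᵖ) :
    G.ihomEquiv X Z (homRep (G.ihomObj X Y) (G.ihomObj X Z) t (G.postcomp X φ) g) x =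
      tripleEval φ (G.ihomEquiv X Y g) x
        (TensorProduct.map LinearMap.id
          (LinearMap.mul' k A ∘ₗ (TensorProduct.comm k A A).toLinearMap)
          (TensorProduct.tensorTensorTensorComm k A A A A
            (TensorProduct.map (forgetOp G.δ) (forgetOp G.δ)
              (TensorProduct.map LinearMap.id (opLinearEquiv k).symm.toLinearMap t)))) := by
  induction t with
  | zero => simp
  | add s t hs ht =>
    simp only [map_add, LinearMap.add_apply, hs, ht]
  | tmul p q =>
    rw [homRep_tmul, ihomEquiv_smul, postcomp_apply, ihomEquiv_smul, homRep_homRep]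
    rfl

/-- `Γ^X_{Y, Z} : Hom_k(Y, Z) → Hom_k(Hom_k(X, Y), Hom_k(X, Z))`, `f ↦ f ∘ -`. -/
def ΓLin (X Y Z : ModuleCat.{u} A) :
    G.ihomObj Y Z →ₗ[A] G.ihomObj (G.ihomObj X Y) (G.ihomObj X Z) where
  toFun f := (G.ihomEquiv _ _).symm (G.postcomp X (G.ihomEquiv Y Z f))
  map_add' f f' := by ext; simp
  map_smul' a f := by
    ext g x
    rw [RingHom.id_apply, AddEquiv.apply_symm_apply, postcomp_apply, LinearMap.comp_apply,
      ihomEquiv_smul, homRep_eq_tripleEval, ← forgetOp_apply, ← G.assoc]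
    exact (G.homRep_postcomp _ _ _ _).symm

@[simp] lemma ΓLin_apply (X Y Z : ModuleCat.{u} A) (f : G.ihomObj Y Z) (g : G.ihomObj X Y) :
    G.ihomEquiv X Z (G.ihomEquiv _ _ (G.ΓLin X Y Z f) g) =
      G.ihomEquiv Y Z f ∘ₗ G.ihomEquiv X Y g := rfl

/-- A linear map between `A`-modules as a morphism of `A-Mod`. -/
def homOfLin {M N : ModuleCat.{u} A} (f : M →ₗ[A] N) : M ⟶ N := ModuleCat.ofHom f

@[simp] lemma homOfLin_apply {M N : ModuleCat.{u} A} (f : M →ₗ[A] N) (m : M) :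
    homOfLin f m = f m := rfl

/-- The skew-closed structure on `A-Mod` lifted from the closed structure of `k-Mod`. -/
def skewClosed : SkewClosedStructure G.ihom G.unit where
  i M := homOfLin (G.iLin M)
  j M := homOfLin (G.jLin M)
  Γ X Y Z := homOfLin (G.ΓLin X Y Z)
  i_natural _ := rfl
  j_dinatural {X Y} f := by
    ext r
    refine G.ihom_ext (M := X) (N := Y) fun m => ?_
    exact (f.hom.restrictScalars k).map_smul _ _
  Γ_natural_left _ _ _ _ _ := rfl
  Γ_natural_right _ _ _ _ _ := rfl
  Γ_dinatural _ _ _ := rfl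
  j_i := by
    ext r
    exact (G.unit_eq_smul_one r).symm
  Γ_j_i X Y := by
    ext f
    refine G.ihom_ext (M := X) (N := Y) fun m => ?_
    exact congrArg (G.ihomEquiv X Y f) (one_smul k m)
  j_Γ X Y := by
    ext r
    refine G.ihom_ext (M := G.ihomObj X Y) (N := G.ihomObj X Y) fun g => ?_
    refine G.ihom_ext fun m => ?_
    exact (DFunLike.congr_fun (G.ihomEquiv_ksmul (G.unitEquiv r) g) m).symm
  Γ_i X Y := rfl
  Γ_Γ _ _ _ _ := rfl

/-- A gabi-algebra is normal if the lifted skew-closed structure on `A-Mod` is normal. -/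
def IsNormal : Prop := G.skewClosed.IsNormal

/-! ### The product `M ⊠ N = (A ⊙ N) ⊗_A M` -/

/-- Right multiplication on `A`, as a left linear map. -/
def mulRightLin : A →ₗ[k] (A →ₗ[A] A) where
  toFun c := LinearMap.toSpanSingleton A A c
  map_add' _ _ := by ext; simp
  map_smul' _ _ := by ext; simp

/-- For `x ⊗ y` the left `A`-linear map `b ⊗ n ↦ b x ⊗ y n` of `A ⊗ N`. -/
def odotRep (N : ModuleCat.{u} A) : A ⊗[k] A →ₗ[k] (A ⊗[k] N →ₗ[A] A ⊗[k] N) :=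
  TensorProduct.AlgebraTensorModule.homTensorHomMap k A k A N A N ∘ₗ
    TensorProduct.map mulRightLin (Algebra.lsmul k k N).toLinearMap

@[simp] lemma odotRep_tmul (N : ModuleCat.{u} A) (x y b : A) (n : N) :
    odotRep (k := k) N (x ⊗ₜ y) (b ⊗ₜ n) = (b * x) ⊗ₜ (y • n) := rfl

/-- The right `A`-action `(b ⊗ n) . c = b c₊ ⊗ c₋ n` on `A ⊙ N`, by left `A`-linear maps. -/
def odotRight (N : ModuleCat.{u} A) (c : A) : A ⊗[k] N →ₗ[A] A ⊗[k] N :=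
  odotRep N (forgetOp G.δ c)

lemma odotRight_one (N : ModuleCat.{u} A) (x : A ⊗[k] N) : G.odotRight N 1 x = x := by
  have h : forgetOp G.δ (1 : A) = 1 ⊗ₜ 1 := by
    rw [forgetOp_apply, map_one, Algebra.TensorProduct.one_def]; simp
  rw [odotRight, h]
  induction x with
  | zero => simp
  | tmul b n => simp
  | add x y hx hy => simp [hx, hy]

lemma odotRight_mul (N : ModuleCat.{u} A) (c d : A) (x : A ⊗[k] N) :
    G.odotRight N (c * d) x = G.odotRight N d (G.odotRight N c x) := by
  have key : ∀ s t : A ⊗[k] Aᵐᵒᵖ,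
      odotRep N (TensorProduct.map LinearMap.id (opLinearEquiv k).symm.toLinearMap (s * t)) x =
      odotRep N (TensorProduct.map LinearMap.id (opLinearEquiv k).symm.toLinearMap t)
        (odotRep N (TensorProduct.map LinearMap.id (opLinearEquiv k).symm.toLinearMap s) x) := by
    intro s t
    induction s with
    | zero => simp
    | add s s' hs hs' => simp only [add_mul, map_add, LinearMap.add_apply, hs, hs']
    | tmul p q =>
      induction t with
      | zero => simp
      | add t t' ht ht' => simp only [mul_add, map_add, LinearMap.add_apply, ht, ht']
      | tmul p' q' =>
        induction x with
        | zero => simp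
        | add x y hx hy => simp only [map_add, hx, hy]
        | tmul b n => simp [mul_assoc, mul_smul]
  have := key (G.δ c) (G.δ d)
  rwa [← map_mul] at this

/-- The bimodule `A ⊙ N`: the `k`-module `A ⊗ N`, with actions
`a . (b ⊗ n) . c = a b c₊ ⊗ c₋ n`. -/
def Odot (_ : GabiAlgebra k A) (N : ModuleCat.{u} A) : Type u := A ⊗[k] N

namespace Odot

variable (N : ModuleCat.{u} A)

instance : AddCommGroup (G.Odot N) := inferInstanceAs (AddCommGroup (A ⊗[k] N))
instance : Module k (G.Odot N) := inferInstanceAs (Module k (A ⊗[k] N))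
instance : Module A (G.Odot N) := inferInstanceAs (Module A (A ⊗[k] N))
instance : IsScalarTower k A (G.Odot N) := inferInstanceAs (IsScalarTower k A (A ⊗[k] N))
instance : SMulCommClass k A (G.Odot N) := inferInstanceAs (SMulCommClass k A (A ⊗[k] N))
instance : SMulCommClass A k (G.Odot N) := inferInstanceAs (SMulCommClass A k (A ⊗[k] N))

/-- The identification of `A ⊙ N` with `A ⊗ N`. -/
def equiv : G.Odot N ≃ₗ[A] A ⊗[k] N := LinearEquiv.refl A (A ⊗[k] N)

/-- The right action on `A ⊙ N`. -/
instance : Module Aᵐᵒᵖ (G.Odot N) where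
  smul c x := (equiv G N).symm (G.odotRight N c.unop (equiv G N x))
  one_smul x := G.odotRight_one N x
  mul_smul c d x := G.odotRight_mul N d.unop c.unop x
  smul_zero c := map_zero (G.odotRight N c.unop)
  smul_add c := map_add (G.odotRight N c.unop)
  add_smul c d x := by
    change odotRep N (forgetOp G.δ (c.unop + d.unop)) x = _
    rw [map_add, map_add]; rfl
  zero_smul x := by
    change odotRep N (forgetOp G.δ 0) x = _
    rw [map_zero, map_zero]; rfl

lemma op_smul (c : A) (x : G.Odot N) :
    equiv G N (op c • x) = odotRep N (forgetOp G.δ c) (equiv G N x) := rfl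

instance : SMulCommClass A Aᵐᵒᵖ (G.Odot N) where
  smul_comm a c x := ((G.odotRight N c.unop).map_smul a x).symm

end Odot

section TensorOver

variable (k) (P : Type u) [AddCommGroup P] [Module k P] [Module A P] [Module Aᵐᵒᵖ P]
  [SMulCommClass k A P] (M : ModuleCat.{u} A)

/-- The relations `p c ⊗ m = p ⊗ c m` defining `P ⊗_A M` as a quotient of `P ⊗_k M`. -/
def tensorOverRel : Submodule A (P ⊗[k] M) :=
  Submodule.span A {z | ∃ (p : P) (c : A) (m : M), z = (op c • p) ⊗ₜ m - p ⊗ₜ (c • m)}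

/-- The left `A`-module `P ⊗_A M`, for an `A`-bimodule `P` and a left `A`-module `M`. -/
def tensorOver : ModuleCat.{u} A := ModuleCat.of A ((P ⊗[k] M) ⧸ tensorOverRel k P M)

variable {P M} in
/-- The element `p ⊗_A m` of `P ⊗_A M`. -/
def tensorOverMk (p : P) (m : M) : tensorOver k P M := (tensorOverRel k P M).mkQ (p ⊗ₜ m)

end TensorOver

/-- `M ⊠ N = (A ⊙ N) ⊗_A M`. -/
def boxObj (M N : ModuleCat.{u} A) : ModuleCat.{u} A := tensorOver k (G.Odot N) M

/-- The element `a ⊙ n` of `A ⊙ N`. -/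
def odot {N : ModuleCat.{u} A} (a : A) (n : N) : G.Odot N := (Odot.equiv G N).symm (a ⊗ₜ n)

lemma odot_induction {N : ModuleCat.{u} A} {p : G.Odot N → Prop} (x : G.Odot N) (zero : p 0)
    (odot : ∀ a n, p (G.odot a n)) (add : ∀ x y, p x → p y → p (x + y)) : p x :=
  TensorProduct.induction_on (motive := p) x zero odot add

/-- The element `(a ⊙ n) ⊗_A m` of `M ⊠ N`. -/
def tmul {M N : ModuleCat.{u} A} (a : A) (n : N) (m : M) : G.boxObj M N :=
  tensorOverMk k (G.odot a n) m

/-- The map `A ⊙ N → A ⊙ N'` induced by `g : N → N'`. -/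
def odotMap {N N' : ModuleCat.{u} A} (g : N ⟶ N') : G.Odot N →ₗ[A] G.Odot N' :=
  (Odot.equiv G N').symm.toLinearMap ∘ₗ
    TensorProduct.AlgebraTensorModule.map (LinearMap.id : A →ₗ[A] A) (g.hom.restrictScalars k) ∘ₗ
      (Odot.equiv G N).toLinearMap

lemma odotRep_natural {N N' : ModuleCat.{u} A} (g : N ⟶ N') (t : A ⊗[k] A) (x : A ⊗[k] N) :
    TensorProduct.AlgebraTensorModule.map (LinearMap.id : A →ₗ[A] A) (g.hom.restrictScalars k)
      (odotRep N t x) = odotRep N' t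
        (TensorProduct.AlgebraTensorModule.map (LinearMap.id : A →ₗ[A] A)
          (g.hom.restrictScalars k) x) := by
  induction t with
  | zero => simp
  | add s t hs ht => simp only [map_add, LinearMap.add_apply, hs, ht]
  | tmul p q =>
    induction x with
    | zero => simp
    | add x y hx hy => simp only [map_add, hx, hy]
    | tmul b n => simp

lemma odotMap_op_smul {N N' : ModuleCat.{u} A} (g : N ⟶ N') (c : A) (x : G.Odot N) :
    G.odotMap g (op c • x) = op c • G.odotMap g x :=
  odotRep_natural g (forgetOp G.δ c) x

/-- The map `(A ⊙ N) ⊗_k M → (A ⊙ N') ⊗_k M'` induced by `f` and `g`. -/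
def boxPre {M M' N N' : ModuleCat.{u} A} (f : M ⟶ M') (g : N ⟶ N') :
    G.Odot N ⊗[k] M →ₗ[A] G.Odot N' ⊗[k] M' :=
  TensorProduct.AlgebraTensorModule.map (G.odotMap g) (f.hom.restrictScalars k)

lemma boxPre_le {M M' N N' : ModuleCat.{u} A} (f : M ⟶ M') (g : N ⟶ N') :
    tensorOverRel k (G.Odot N) M ≤ (tensorOverRel k (G.Odot N') M').comap (G.boxPre f g) := by
  refine Submodule.span_le.2 ?_
  rintro _ ⟨x, c, m, rfl⟩
  refine Submodule.subset_span ⟨G.odotMap g x, c, f m, ?_⟩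
  simp [boxPre, odotMap_op_smul]

/-- The action `f ⊠ g` of the product on morphisms. -/
def boxMap {M M' N N' : ModuleCat.{u} A} (f : M ⟶ M') (g : N ⟶ N') :
    G.boxObj M N ⟶ G.boxObj M' N' :=
  ModuleCat.ofHom (Submodule.mapQ _ _ (G.boxPre f g) (G.boxPre_le f g))

@[simp] lemma boxMap_tmul {M M' N N' : ModuleCat.{u} A} (f : M ⟶ M') (g : N ⟶ N')
    (a : A) (n : N) (m : M) : G.boxMap f g (G.tmul a n m) = G.tmul a (g n) (f m) := rfl

variable {G} in
lemma tmul_induction {M N : ModuleCat.{u} A} {p : G.boxObj M N → Prop} (z : G.boxObj M N)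
    (zero : p 0) (tmul : ∀ a n m, p (G.tmul a n m)) (add : ∀ x y, p x → p y → p (x + y)) :
    p z := by
  obtain ⟨z, rfl⟩ := (tensorOverRel k (G.Odot N) M).mkQ_surjective z
  induction z with
  | zero => rw [map_zero]; exact zero
  | add x y hx hy => rw [map_add]; exact add _ _ hx hy
  | tmul x m =>
    induction x using G.odot_induction with
    | zero => rw [TensorProduct.zero_tmul, map_zero]; exact zero
    | add x y hx hy => rw [TensorProduct.add_tmul, map_add]; exact add _ _ hx hy
    | odot a n => exact tmul a n m

variable {G} in
lemma box_hom_ext {M N P : ModuleCat.{u} A} {f g : G.boxObj M N ⟶ P}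
    (h : ∀ a n m, f (G.tmul a n m) = g (G.tmul a n m)) : f = g := by
  ext z
  exact tmul_induction (p := fun z => f z = g z) z (by rw [map_zero, map_zero]) h
    (fun x y hx hy => by rw [map_add, map_add, hx, hy])

/-- The bifunctor `⊠`, where `(G.box.obj M).obj N` is `M ⊠ N`. -/
def box : ModuleCat.{u} A ⥤ ModuleCat.{u} A ⥤ ModuleCat.{u} A where
  obj M :=
    { obj := fun N => G.boxObj M N
      map := fun g => G.boxMap (𝟙 M) g
      map_id := fun _ => box_hom_ext fun _ _ _ => rfl
      map_comp := fun _ _ => box_hom_ext fun _ _ _ => rfl }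
  map f :=
    { app := fun N => G.boxMap f (𝟙 N)
      naturality := fun _ _ _ => box_hom_ext fun _ _ _ => rfl }
  map_id _ := by ext N : 2; exact box_hom_ext fun _ _ _ => rfl
  map_comp _ _ := by ext N : 2; exact box_hom_ext fun _ _ _ => rfl

end GabiAlgebra

namespace GabiAlgebra

variable {k A : Type u} [CommRing k] [Ring A] [Algebra k A] (G : GabiAlgebra k A)

/-! ### Calculus in `M ⊠ N` -/

section Calculus

variable {M N P Q R : ModuleCat.{u} A}

/-! Everything follows from the adjunction `- ⊠ N ⊣ [N, -]` (`boxHomEquiv`). The balancing relation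
of `⊗_A`, written on generators, is (1 ⊙ n) ⊗ cm = c₊((1 ⊙ c₋n) ⊗ m), which says precisely that m ↦
(n ↦ (1 ⊙ n) ⊗ m) is A-linear for the action on Hom_k. The unitors and the associator are therefore
built from `j`, `i` and `Γ` by transposition, so their A-linearity comes from the gabi axioms
already used for the skew-closed structure.

By transposing, a map out of an iterated left-bracketed product is determined by its values on
generators all of whose A-coefficients are 1 (`box_hom_ext_one`, `box_box_hom_ext`). There δ(1) = 1
⊗ 1 makes the associator plain rebracketing, and the skew-monoidal axioms become immediate.

For strength, a morphism is invertible iff precomposition with it is bijective for every target.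
Transposition turns precomposition with λ into the left normality map. By co-Yoneda the coend is C(U
⊠ (X ⊠ Y), Z), and the associative normality map becomes precomposition with α followed by two
transpositions (`toCoend_bijective`, `coendMap_toCoend`). Right normality and invertibility of ρ
always hold, because Hom_k(k, M) ≅ M. -/

lemma tensorOverMk_smul (p : G.Odot N) (c : A) (m : M) :
    tensorOverMk k p (c • m) = tensorOverMk k (op c • p) m :=
  by
  refine Eq.symm ((Submodule.Quotient.eq (tensorOverRel k (G.Odot N) M)).2 ?_)
  exact Submodule.subset_span ⟨p, c, m, rfl⟩

lemma smul_tmul (a b : A) (n : N) (m : M) : a • G.tmul b n m = G.tmul (a * b) n m := rfl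

lemma tmul_eq_smul (a : A) (n : N) (m : M) : G.tmul a n m = a • G.tmul 1 n m := by
  rw [smul_tmul, mul_one]

lemma tmul_add_left (a : A) (n n' : N) (m : M) :
    G.tmul a (n + n') m = G.tmul a n m + G.tmul a n' m := by
  change tensorOverMk k ((Odot.equiv G N).symm _) m = _
  rw [TensorProduct.tmul_add, map_add, tensorOverMk, TensorProduct.add_tmul, map_add]
  rfl

lemma tmul_add_right (a : A) (n : N) (m m' : M) :
    G.tmul a n (m + m') = G.tmul a n m + G.tmul a n m' := by
  simp only [tmul, tensorOverMk, TensorProduct.tmul_add, map_add]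
  rfl

lemma tmul_ksmul_left (a : A) (r : k) (n : N) (m : M) :
    G.tmul a (r • n) m = r • G.tmul a n m := by
  -- The k-action on M ⊠ N is restricted along k → A, so r first lands on the coefficient a.
  rw [kModule_smul (A := A) (G.boxObj M N), smul_tmul, ← Algebra.smul_def]
  change tensorOverMk k ((Odot.equiv G N).symm (a ⊗ₜ[k] (r • n))) m = _
  rw [← TensorProduct.smul_tmul]
  rfl

lemma tmul_ksmul_right (a : A) (r : k) (n : N) (m : M) :
    G.tmul a n (r • m) = r • G.tmul a n m := by
  rw [← tmul_ksmul_left]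
  change tensorOverMk k (G.odot a n) (r • m) = tensorOverMk k (G.odot a (r • n)) m
  rw [tensorOverMk, ← TensorProduct.smul_tmul]
  change _ = (tensorOverRel k (G.Odot N) M).mkQ
    ((Odot.equiv G N).symm (a ⊗ₜ[k] (r • n)) ⊗ₜ m)
  rw [TensorProduct.tmul_smul]
  rfl

/-- The `k`-linear map `n ↦ (1 ⊙ n) ⊗_A m`. -/
def tmulLin (N : ModuleCat.{u} A) (m : M) : N →ₗ[k] G.boxObj M N where
  toFun n := G.tmul 1 n m
  map_add' n n' := G.tmul_add_left 1 n n' m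
  map_smul' r n := G.tmul_ksmul_left 1 r n m

@[simp] lemma tmulLin_apply (m : M) (n : N) : G.tmulLin N m n = G.tmul 1 n m := rfl

/-- An arbitrary tensor t replaces δ(c) so that induction on tensors is available; δ(c) itself need
not be pure. -/
lemma tensorOverMk_odotRep (t : A ⊗[k] Aᵐᵒᵖ) (n : N) (m : M) :
    tensorOverMk k ((Odot.equiv G N).symm (odotRep N (TensorProduct.map LinearMap.id
      (opLinearEquiv k).symm.toLinearMap t) (1 ⊗ₜ n))) m =
      homRep N (G.boxObj M N) t (G.tmulLin N m) n := by
  induction t with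
  | zero =>
    simp only [map_zero, LinearMap.zero_apply, tensorOverMk, TensorProduct.zero_tmul]
    rfl
  | add s t hs ht =>
    rw [map_add (homRep _ _), LinearMap.add_apply, LinearMap.add_apply, ← hs, ← ht, map_add,
      map_add, LinearMap.add_apply, map_add, tensorOverMk, TensorProduct.add_tmul, map_add]
    rfl
  | tmul x y =>
    rw [homRep_tmul, tmulLin_apply, ← tmul_eq_smul, TensorProduct.map_tmul, odotRep_tmul, one_mul]
    rfl

/-- The relation `(1 ⊙ n) ⊗_A c m = c₊ ((1 ⊙ c₋ n) ⊗_A m)`. -/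
lemma tmul_smul (c : A) (n : N) (m : M) :
    G.tmul 1 n (c • m) = homRep N (G.boxObj M N) (G.δ c) (G.tmulLin N m) n := by
  rw [← tensorOverMk_odotRep]
  exact G.tensorOverMk_smul (G.odot 1 n) c m

/-! ### The adjunction between product and internal hom -/

/-- The unit `M → [N, M ⊠ N]`, `m ↦ (n ↦ (1 ⊙ n) ⊗_A m)`, of the adjunction `- ⊠ N ⊣ [N, -]`. -/
def coev (M N : ModuleCat.{u} A) : M ⟶ G.ihomObj N (G.boxObj M N) :=
  homOfLin
    { toFun := fun m => (G.ihomEquiv N (G.boxObj M N)).symm (G.tmulLin N m)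
      map_add' := fun m m' => by ext n; exact G.tmul_add_right 1 n m m'
      map_smul' := fun c m => by ext n; exact G.tmul_smul c n m }

@[simp] lemma coev_apply (m : M) (n : N) :
    G.ihomEquiv N (G.boxObj M N) (G.coev M N m) n = G.tmul 1 n m := rfl

/-- The morphism `M → [N, P]`, `m ↦ (n ↦ f ((1 ⊙ n) ⊗_A m))`, adjunct to `f : M ⊠ N → P`. -/
def curry (f : G.boxObj M N ⟶ P) : M ⟶ G.ihomObj N P := G.coev M N ≫ G.ihomMap (𝟙 N) f

@[simp] lemma curry_apply (f : G.boxObj M N ⟶ P) (m : M) (n : N) :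
    G.ihomEquiv N P (G.curry f m) n = f (G.tmul 1 n m) := rfl

/-- The map `(a ⊙ n) ⊗_k m ↦ a g(m)(n)`. -/
def uncurryPre (g : M ⟶ G.ihomObj N P) : G.Odot N ⊗[k] M →ₗ[A] P :=
  TensorProduct.AlgebraTensorModule.lift
    (TensorProduct.AlgebraTensorModule.lift
      (LinearMap.toSpanSingleton A (N →ₗ[k] M →ₗ[k] P)
        (LinearMap.flip
          { toFun := fun m => G.ihomEquiv N P (g m)
            map_add' := fun m m' => by rw [map_add, map_add]
            map_smul' := fun r m => by
              rw [RingHom.id_apply, ← ihomEquiv_ksmul]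
              exact congrArg _ (g.hom.map_smul (algebraMap k A r) m) })) ∘ₗ
      (Odot.equiv G N).toLinearMap)

lemma uncurryPre_tmul (g : M ⟶ G.ihomObj N P) (a : A) (n : N) (m : M) :
    G.uncurryPre g (G.odot a n ⊗ₜ m) = a • G.ihomEquiv N P (g m) n := rfl

lemma uncurryPre_odotRep (g : M ⟶ G.ihomObj N P) (t : A ⊗[k] Aᵐᵒᵖ) (a : A) (n : N) (m : M) :
    G.uncurryPre g ((Odot.equiv G N).symm (odotRep N (TensorProduct.map LinearMap.id
      (opLinearEquiv k).symm.toLinearMap t) (a ⊗ₜ n)) ⊗ₜ m) =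
      a • homRep N P t (G.ihomEquiv N P (g m)) n := by
  induction t with
  | zero => simp
  | add s t hs ht =>
    rw [map_add, map_add, map_add, LinearMap.add_apply, LinearMap.add_apply, LinearMap.add_apply,
      map_add, TensorProduct.add_tmul, map_add, hs, ht, smul_add]
  | tmul x y =>
    rw [homRep_tmul, TensorProduct.map_tmul, odotRep_tmul, ← mul_smul]
    exact G.uncurryPre_tmul g _ _ _

/-- The right action on A ⊙ N and the action on Hom_k(N, P) are both defined through δ, so
A-linearity of g is what kills the balancing relations. -/
lemma uncurryPre_le (g : M ⟶ G.ihomObj N P) :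
    tensorOverRel k (G.Odot N) M ≤ LinearMap.ker (G.uncurryPre g) := by
  refine Submodule.span_le.2 ?_
  rintro _ ⟨x, c, m, rfl⟩
  rw [SetLike.mem_coe, LinearMap.mem_ker, map_sub, sub_eq_zero]
  induction x using G.odot_induction with
  | zero => simp
  | add x y hx hy => rw [smul_add, TensorProduct.add_tmul, TensorProduct.add_tmul, map_add, map_add,
      hx, hy]
  | odot a n =>
    rw [uncurryPre_tmul, map_smul, ihomEquiv_smul, ← uncurryPre_odotRep]
    rfl

/-- The morphism `M ⊠ N → P`, `(a ⊙ n) ⊗_A m ↦ a g(m)(n)`, adjunct to `g : M → [N, P]`. -/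
def uncurry (g : M ⟶ G.ihomObj N P) : G.boxObj M N ⟶ P :=
  ModuleCat.ofHom ((tensorOverRel k (G.Odot N) M).liftQ (G.uncurryPre g) (G.uncurryPre_le g))

@[simp] lemma uncurry_tmul (g : M ⟶ G.ihomObj N P) (a : A) (n : N) (m : M) :
    G.uncurry g (G.tmul a n m) = a • G.ihomEquiv N P (g m) n := rfl

variable {G} in
lemma box_hom_ext_one {f g : G.boxObj M N ⟶ P}
    (h : ∀ n m, f (G.tmul 1 n m) = g (G.tmul 1 n m)) : f = g :=
  box_hom_ext fun a n m => by rw [tmul_eq_smul, map_smul, map_smul, h]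

/-- The tensor-hom adjunction between `- ⊠ N` and `[N, -]`. -/
def boxHomEquiv (M N P : ModuleCat.{u} A) : (G.boxObj M N ⟶ P) ≃ (M ⟶ G.ihomObj N P) where
  toFun := G.curry
  invFun := G.uncurry
  left_inv f := box_hom_ext_one fun n m => by rw [uncurry_tmul, one_smul, curry_apply]
  right_inv g := by
    ext m n
    rw [curry_apply, uncurry_tmul, one_smul]

variable {G} in
-- The inner coefficient cannot be pulled out of the product directly, but the transposes M ⊠ N →
-- [P, Q] are A-linear, so it may be taken to be 1 as well.
lemma box_box_hom_ext {f g : G.boxObj (G.boxObj M N) P ⟶ Q}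
    (h : ∀ p n m, f (G.tmul 1 p (G.tmul 1 n m)) = g (G.tmul 1 p (G.tmul 1 n m))) : f = g :=
  (G.boxHomEquiv _ _ _).injective (box_hom_ext_one fun n m => G.ihom_ext fun p => h p n m)

variable {G} in
lemma box_box_box_hom_ext {f g : G.boxObj (G.boxObj (G.boxObj M N) P) Q ⟶ R}
    (h : ∀ q p n m, f (G.tmul 1 q (G.tmul 1 p (G.tmul 1 n m))) =
      g (G.tmul 1 q (G.tmul 1 p (G.tmul 1 n m)))) : f = g :=
  (G.boxHomEquiv _ _ _).injective (box_box_hom_ext fun p n m => G.ihom_ext fun q => h q p n m)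

end Calculus

/-! ### The skew-monoidal structure -/

/-- The left unitor `(a ⊙ n) ⊗_A r ↦ r a n`. -/
def leftUnitor (N : ModuleCat.{u} A) : G.boxObj G.unit N ⟶ N :=
  G.uncurry (homOfLin (G.jLin N))

lemma leftUnitor_tmul (N : ModuleCat.{u} A) (a : A) (n : N) (r : G.unit) :
    G.leftUnitor N (G.tmul a n r) = a • G.unitEquiv r • n := rfl

/-- The right unitor `m ↦ (1 ⊙ 1) ⊗_A m`. -/
def rightUnitor (M : ModuleCat.{u} A) : M ⟶ G.boxObj M G.unit :=
  G.coev M G.unit ≫ homOfLin (G.iLin _)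

@[simp] lemma rightUnitor_apply (M : ModuleCat.{u} A) (m : M) :
    G.rightUnitor M m = G.tmul 1 G.one m := rfl

/-- The associator, adjunct to `l ↦ (m ↦ (n ↦ (1 ⊙ ((1 ⊙ n) ⊗_A m)) ⊗_A l))`. -/
def associator (L M N : ModuleCat.{u} A) :
    G.boxObj (G.boxObj L M) N ⟶ G.boxObj L (G.boxObj M N) :=
  G.uncurry (G.uncurry (G.coev L (G.boxObj M N) ≫ homOfLin (G.ΓLin N _ _) ≫
    G.ihomMap (G.coev M N) (𝟙 _)))

section Structure

variable {L M N : ModuleCat.{u} A}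

lemma associator_tmul (a b : A) (n : N) (m : M) (l : L) :
    G.associator L M N (G.tmul a n (G.tmul b m l)) =
      a • homRep N (G.boxObj L (G.boxObj M N)) (G.δ b)
        (G.tmulLin (G.boxObj M N) l ∘ₗ G.tmulLin N m) n := rfl

-- Here δ(1) = 1 ⊗ 1 leaves nothing to distribute. This is the only formula for the associator that
-- the skew-monoidal axioms need.
@[simp] lemma associator_tmul_one (n : N) (m : M) (l : L) :
    G.associator L M N (G.tmul 1 n (G.tmul 1 m l)) = G.tmul 1 (G.tmul 1 n m) l := by
  rw [associator_tmul, map_one, map_one, one_smul]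
  rfl

/-- The families x and y make the Sweedler notation b₊ ⊗ b₋ literal, for any presentation of δ(b) as
a finite sum of pure tensors. -/
lemma associator_tmul_sum (a b : A) (n : N) (m : M) (l : L) (r : ℕ) (x y : Fin r → A)
    (h : G.δ b = ∑ i, x i ⊗ₜ[k] op (y i)) :
    G.associator L M N (G.tmul a n (G.tmul b m l)) =
      ∑ i, G.tmul (a * x i) (G.tmul 1 (y i • n) m) l := by
  rw [associator_tmul, h, map_sum, LinearMap.sum_apply, LinearMap.sum_apply, Finset.smul_sum]
  refine Finset.sum_congr rfl fun i _ => ?_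
  rw [homRep_tmul, ← mul_smul, G.tmul_eq_smul (a * x i)]
  rfl

end Structure

/-- The skew-monoidal structure on `A-Mod` corresponding to the skew-closed one. -/
def skewMonoidal : SkewMonoidalStructure G.box G.unit where
  α := G.associator
  l := G.leftUnitor
  ρ := G.rightUnitor
  α_natural_left f Y Z := box_box_hom_ext fun z y x =>
    (G.associator_tmul_one z y (f x)).trans
      (congrArg (G.boxMap f (𝟙 _)) (G.associator_tmul_one z y x)).symm
  α_natural_middle X Y Y' f Z := box_box_hom_ext fun z y x =>
    (G.associator_tmul_one z (f y) x).trans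
      (congrArg (G.boxMap (𝟙 X) (G.boxMap f (𝟙 Z))) (G.associator_tmul_one z y x)).symm
  α_natural_right X Y Z Z' f := box_box_hom_ext fun z y x =>
    (G.associator_tmul_one (f z) y x).trans
      (congrArg (G.boxMap (𝟙 X) (G.boxMap (𝟙 Y) f)) (G.associator_tmul_one z y x)).symm
  l_natural f := box_hom_ext_one fun n r => by
    change (1 : A) • G.unitEquiv r • f n = f ((1 : A) • G.unitEquiv r • n)
    rw [map_smul]
    exact congrArg _ ((f.hom.restrictScalars k).map_smul _ _).symm
  ρ_natural _ := rfl
  pentagon W X Y Z := box_box_box_hom_ext fun z y x w => by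
    change G.boxMap (𝟙 W) (G.associator X Y Z) (G.associator W (G.boxObj X Y) Z
        (G.boxMap (G.associator W X Y) (𝟙 Z) (G.tmul 1 z (G.tmul 1 y (G.tmul 1 x w))))) =
      G.associator W X (G.boxObj Y Z) (G.associator (G.boxObj W X) Y Z
        (G.tmul 1 z (G.tmul 1 y (G.tmul 1 x w))))
    -- Both sides rebracket to (1 ⊙ ((1 ⊙ ((1 ⊙ z) ⊗ y)) ⊗ x)) ⊗ w.
    simp
  ρ_α X Y := box_hom_ext_one fun y x => G.associator_tmul_one G.one y x
  α_l X Y := box_box_hom_ext fun y x r => by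
    change G.leftUnitor (G.boxObj X Y) (G.associator G.unit X Y
        (G.tmul 1 y (G.tmul 1 x r))) =
      G.boxMap (G.leftUnitor X) (𝟙 Y) (G.tmul 1 y (G.tmul 1 x r))
    rw [associator_tmul_one, leftUnitor_tmul, boxMap_tmul, leftUnitor_tmul, one_smul, one_smul,
      tmul_ksmul_right]
    rfl
  ρ_α_l X Y := box_hom_ext_one fun y x => by
    change G.boxMap (𝟙 X) (G.leftUnitor Y) (G.associator X G.unit Y
        (G.boxMap (G.rightUnitor X) (𝟙 Y) (G.tmul 1 y x))) = G.tmul 1 y x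
    rw [boxMap_tmul, rightUnitor_apply, associator_tmul_one, boxMap_tmul, leftUnitor_tmul,
      one_smul, unitEquiv_one, one_smul]
    rfl
  ρ_l := by
    ext r
    change (1 : A) • G.unitEquiv r • G.one = r
    rw [one_smul, ← unit_eq_smul_one]

/-! ### Strength and normality -/

section Normality

/-! ### The unitors -/

/-- A k-linear map out of k is determined by its value at 1, which is arbitrary. Hence right
normality is no condition on the gabi-algebra. -/
lemma isIso_i (M : ModuleCat.{u} A) : IsIso (G.skewClosed.i M) := by
  refine (ConcreteCategory.isIso_iff_bijective _).2 ⟨fun φ ψ h => ?_, fun m => ?_⟩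
  · refine G.ihom_ext fun r => ?_
    rw [G.unit_eq_smul_one r, map_smul, map_smul]
    exact congrArg _ h
  · refine ⟨(G.ihomEquiv G.unit M).symm
      { toFun := fun r => G.unitEquiv r • m
        map_add' := fun r s => by rw [map_add, add_smul]
        map_smul' := fun r s => by rw [unitEquiv_ksmul, mul_smul, RingHom.id_apply] }, ?_⟩
    exact one_smul k m

/-- The adjunct of `m ↦ (r ↦ r m)`, the inverse of `i_M`, is inverse to the right unitor. -/
lemma isIso_rightUnitor (M : ModuleCat.{u} A) : IsIso (G.rightUnitor M) := by
  obtain ⟨(v : M ⟶ G.ihomObj G.unit M), -, h⟩ := G.isIso_i M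
  have hinv (m : M) : G.ihomEquiv G.unit M (v m) G.one = m := ConcreteCategory.congr_hom h m
  refine ⟨G.uncurry v, ?_, box_hom_ext_one fun r m => ?_⟩
  · ext m
    exact (one_smul A _).trans (hinv m)
  · change G.rightUnitor M (G.uncurry _ (G.tmul 1 r m)) = G.tmul 1 r m
    -- Writing r as a multiple of 1 lets the scalar cross from the M-factor to the k-factor.
    rw [uncurry_tmul, one_smul, G.unit_eq_smul_one r, map_smul, hinv, rightUnitor_apply,
      tmul_ksmul_right, tmul_ksmul_left]

/-- Yoneda: surjectivity at Z = X yields a retraction of f, and injectivity at Z = Y makes it a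
two-sided inverse. -/
lemma isIso_iff_precomp_bijective {C : Type*} [Category C] {X Y : C} (f : X ⟶ Y) :
    IsIso f ↔ ∀ Z : C, Function.Bijective (fun g : Y ⟶ Z => f ≫ g) :=
  ⟨fun _ _ => (asIso f).symm.homFromEquiv.bijective, fun h => by
    obtain ⟨g, hg⟩ := (h X).2 (𝟙 X)
    exact ⟨g, hg, (h Y).1 (by simp [reassoc_of% hg])⟩⟩

/-- Transposing f ∘ λ_X gives r ↦ (x ↦ f(rx)), while the normality map gives r ↦ (x ↦ r f(x)); they
agree because f is k-linear. -/
lemma isLeftNormal_iff : G.skewClosed.IsLeftNormal ↔ ∀ X, IsIso (G.leftUnitor X) := by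
  refine forall_congr' fun X => ?_
  rw [isIso_iff_precomp_bijective]
  refine forall_congr' fun Y => ?_
  rw [← (G.boxHomEquiv G.unit X Y).comp_bijective]
  refine iff_of_eq (congrArg _ (funext fun f => ?_))
  ext r
  refine G.ihom_ext fun x => ?_
  change G.unitEquiv r • f x = f ((1 : A) • G.unitEquiv r • x)
  rw [one_smul]
  exact ((f.hom.restrictScalars k).map_smul _ _).symm

/-! ### The associator and the coend -/

open SkewClosedStructure

variable (U X Y Z : ModuleCat.{u} A)

/-- The map `φ ↦ [(X ⊠ Y, φ̂, η)]`, with `φ̂ : U → [X ⊠ Y, Z]` adjunct to `φ` and `η` the unit of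
the adjunction. By the co-Yoneda lemma it is a bijection onto the coend. -/
def toCoend (φ : G.boxObj U (G.boxObj X Y) ⟶ Z) : Coend G.ihom U X Y Z :=
  Quot.mk _ ⟨G.boxObj X Y, G.curry φ, G.coev X Y⟩

/-- The map sending the class of `(f, g)` to the composite of `U ⊠ ĝ` and `f̂`. -/
def ofCoend : Coend G.ihom U X Y Z → (G.boxObj U (G.boxObj X Y) ⟶ Z) :=
  Quot.lift (fun p => G.boxMap (𝟙 U) (G.uncurry (M := X) (N := Y) p.2.2) ≫
      G.uncurry (M := U) (N := p.1) p.2.1) (by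
    rintro _ _ ⟨h, f, g⟩
    refine box_hom_ext_one fun t u => ?_
    change (1 : A) • G.ihomEquiv _ _ (f u) (h (G.uncurry (M := X) (N := Y) g t)) =
      (1 : A) • G.ihomEquiv _ _ (f u) (G.uncurry (M := X) (N := Y) (g ≫ G.ihomMap (𝟙 Y) h) t)
    -- Transposition is natural in V.
    have : G.uncurry (M := X) (N := Y) g ≫ h =
        G.uncurry (M := X) (N := Y) (g ≫ G.ihomMap (𝟙 Y) h) :=
      box_hom_ext fun a y x => map_smul h.hom a _
    rw [← this]
    rfl)

/-- By adjunction C(X, [Y, V]) ≅ C(X ⊠ Y, V) is representable in V, so every class has a unique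
representative at V = X ⊠ Y whose second component is the unit η. -/
lemma toCoend_bijective : Function.Bijective (G.toCoend U X Y Z) := by
  refine Function.bijective_iff_has_inverse.2 ⟨G.ofCoend U X Y Z, fun φ => ?_, ?_⟩
  · have h : G.uncurry (G.coev X Y) = 𝟙 _ :=
      box_hom_ext_one fun y x => one_smul A (G.tmul 1 y x)
    change G.boxMap (𝟙 U) (G.uncurry (G.coev X Y)) ≫ G.uncurry (G.curry φ) = φ
    rw [h]
    exact box_hom_ext_one fun t u => one_smul A (φ (G.tmul 1 t u))
  · rintro ⟨⟨V, f, g⟩⟩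
    have hg : G.coev X Y ≫ (G.ihom.obj (.op Y)).map (G.uncurry (M := X) (N := Y) g) = g :=
      (G.boxHomEquiv X Y V).right_inv g
    have hf : G.curry (G.boxMap (𝟙 U) (G.uncurry (M := X) (N := Y) g) ≫
        G.uncurry (M := U) (N := V) f) =
          f ≫ (G.ihom.map (G.uncurry (M := X) (N := Y) g).op).app Z := by
      ext u t
      exact one_smul A _
    -- Since g is η followed by [Y, ĝ], the coend relation along h = ĝ identifies (X ⊠ Y, [ĝ, Z] ∘
    -- f, η) with (V, f, g).
    refine Eq.trans ?_ ((Quot.sound (CoendRel.mk (G.uncurry (M := X) (N := Y) g) f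
      (G.coev X Y))).trans ?_)
    · rw [← hf]
      rfl
    · exact congrArg (fun g => Quot.mk (CoendRel G.ihom U X Y Z) ⟨V, f, g⟩) hg

/-- Both sides send u to x ↦ (y ↦ φ((1 ⊙ ((1 ⊙ y) ⊗ x)) ⊗ u)). -/
lemma coendMap_toCoend (φ : G.boxObj U (G.boxObj X Y) ⟶ Z) :
    G.skewClosed.coendMap U X Y Z (G.toCoend U X Y Z φ) =
      G.boxHomEquiv _ _ _ (G.boxHomEquiv _ _ _ (G.associator U X Y ≫ φ)) := by
  ext u
  refine G.ihom_ext (M := X) (N := G.ihomObj Y Z) fun x => G.ihom_ext fun y => ?_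
  exact congrArg φ (G.associator_tmul_one y x u).symm

lemma isAssociativeNormal_iff :
    G.skewClosed.IsAssociativeNormal ↔ ∀ X Y Z, IsIso (G.associator X Y Z) := by
  refine forall_congr' fun U => forall_congr' fun X => forall_congr' fun Y => ?_
  rw [isIso_iff_precomp_bijective]
  refine forall_congr' fun Z => ?_
  -- Composing with bijections on either side makes the two maps literally comparable.
  rw [← Function.Bijective.of_comp_iff _ (G.toCoend_bijective U X Y Z),
    ← (G.boxHomEquiv _ _ _).comp_bijective, ← (G.boxHomEquiv _ _ _).comp_bijective]
  exact iff_of_eq (congrArg _ (funext fun φ => G.coendMap_toCoend U X Y Z φ))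

lemma skewMonoidal_isStrong_iff : G.skewMonoidal.IsStrong ↔ G.IsNormal :=
  and_congr G.isLeftNormal_iff.symm (and_congr
    -- The right-hand conditions are equivalent because both always hold.
    (iff_of_true G.isIso_rightUnitor G.isIso_i) G.isAssociativeNormal_iff.symm)

end Normality

end GabiAlgebra

theorem proposition4p7 {k A : Type u} [CommRing k] [Ring A] [Algebra k A]
    (G : GabiAlgebra k A) :
    ∃ S : SkewMonoidalStructure G.box G.unit,
      (∀ (N : ModuleCat.{u} A) (a : A) (n : N),
        S.l N (G.tmul (M := G.unit) a n G.one) = a • n) ∧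
      (∀ (M : ModuleCat.{u} A) (m : M),
        S.ρ M m = G.tmul (N := G.unit) 1 G.one m) ∧
      (∀ M : ModuleCat.{u} A, IsIso (S.ρ M)) ∧
      (∀ (L M N : ModuleCat.{u} A) (a b : A) (n : N) (m : M) (l : L)
        (r : ℕ) (x y : Fin r → A), G.δ b = ∑ i, x i ⊗ₜ[k] op (y i) →
          S.α L M N (G.tmul (M := G.boxObj L M) a n (G.tmul b m l)) =
            ∑ i, G.tmul (N := G.boxObj M N) (a * x i) (G.tmul 1 (y i • n) m) l) ∧
      (S.IsStrong ↔ G.IsNormal) :=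
  ⟨G.skewMonoidal,
    fun _ a n => congrArg (a • ·) (one_smul k n),
    fun _ _ => rfl,
    G.isIso_rightUnitor,
    fun _ _ _ a b n m l r x y h => G.associator_tmul_sum a b n m l r x y h,
    G.skewMonoidal_isStrong_iff⟩
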